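/- There exist universal constants $0<c\le C<\infty$ such that the following holds. Let $\alpha\in[0,1)$, let $\kappa_n$ ($n\ge 1$) be $0$-$1$ random variables with $\mathbb{P}(\kappa_n=0)=\alpha$, $\mathbb{P}(\kappa_n=1)=1-\alpha$, and let $\theta_n$ ($n\ge1$) be exponential random variables with expectation $1$, all the variables $\kappa_1,\kappa_2,\ldots,\theta_1,\theta_2,\ldots$ being independent. Let $a_1\ge a_2\ge\ldots\ge 0$ be real numbers with $\sum_{n\ge1}a_n<\infty$, and let $p\ge 2$ be real. Write $\|X\|_p=(\mathbb{E}|X|^p)^{1/p}$. Then the series $\sum_{n\ge1}a_n\kappa_n\theta_n$ converges almost surely, its sum and the variable \[ \sigma=a_1\theta_1+\sum_{n>1}a_n\kappa_n\theta_n \] have finite $p$-th moments, and \[ c\,A\le\Big\|\sum_{n\ge1}a_n\kappa_n\theta_n\Big\|_p\le C\,A,\qquad A=p\,(1-\alpha)^{1/p}\Big(\sum_{n\ge1}\alpha^{n-1}a_n^p\Big)^{1/p}+(1-\alpha)\sum_{n\ge1}a_n, \] \[ c\,B\le\|\sigma\|_p\le C\,B,\qquad B=p\,a_1+(1-\alpha)\sum_{n>1}a_n,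 \] where $0^0=1$ (relevant for $\alpha=0$, $n=1$). -/

import Mathlib

open MeasureTheory ProbabilityTheory

/-- The product `a n * κ n * θ n`, summed over `n`: the convolution of elementary mixtures of
exponential distributions. Sequences are indexed from `0`, so the entry `n` here is the term with
number `n + 1` in the usual numbering. -/
noncomputable def mixtureSum {Ω : Type*} (a : ℕ → ℝ) (κ θ : ℕ → Ω → ℝ) (ω : Ω) : ℝ :=
  ∑' n, a n * κ n ω * θ n ω

/-- The same sum, with the first factor `κ` replaced by `1`. -/
noncomputable def mixtureSigma {Ω : Type*} (a : ℕ → ℝ) (κ θ : ℕ → Ω → ℝ) (ω : Ω) : ℝ :=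
  a 0 * θ 0 ω + ∑' n, a (n + 1) * κ (n + 1) ω * θ (n + 1) ω

/-- The `κ n` are `0`-`1` random variables with `P(κ n = 0) = α`, the `θ n` are exponential random
variables with expectation `1`, and all the variables `κ 0, κ 1, …, θ 0, θ 1, …` together are
independent. -/
structure IsMixtureSetting {Ω : Type*} [MeasurableSpace Ω] (μ : Measure Ω) (α : ℝ)
    (κ θ : ℕ → Ω → ℝ) : Prop where
  measurable_kappa : ∀ n, Measurable (κ n)
  prob_kappa_zero : ∀ n, μ {ω | κ n ω = 0} = ENNReal.ofReal α
  prob_kappa_one : ∀ n, μ {ω | κ n ω = 1} = ENNReal.ofReal (1 - α)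
  measurable_theta : ∀ n, Measurable (θ n)
  law_theta : ∀ n, μ.map (θ n) = expMeasure 1
  indep : iIndepFun (Sum.elim κ θ) μ

lemma lintegral_expMeasure_one {f : ℝ → ENNReal} (hf : Measurable f) :
    ∫⁻ x, f x ∂(expMeasure 1) = ∫⁻ x, exponentialPDF 1 x * f x := by
  have h : Measurable (gammaPDF 1 1) := (measurable_gammaPDFReal 1 1).ennreal_ofReal
  rw [expMeasure, gammaMeasure, lintegral_withDensity_eq_lintegral_mul _ h hf]
  rfl

lemma lintegral_exp_mul_expMeasure {s : ℝ} (hs : s < 1) :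
    ∫⁻ x, ENNReal.ofReal (Real.exp (s * x)) ∂(expMeasure 1) = ENNReal.ofReal (1 / (1 - s)) := by
  have hs' : 0 < 1 - s := by linarith
  have h : Measurable (exponentialPDF (1 - s)) :=
    (measurable_exponentialPDFReal (1 - s)).ennreal_ofReal
  rw [lintegral_expMeasure_one (by fun_prop), ← mul_one (ENNReal.ofReal (1 / (1 - s))),
    ← lintegral_exponentialPDF_eq_one hs', ← lintegral_const_mul _ h]
  congr with x
  rw [exponentialPDF_eq, exponentialPDF_eq, ← ENNReal.ofReal_mul (by split_ifs <;> positivity),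
    ← ENNReal.ofReal_mul (by positivity)]
  congr 1
  split_ifs
  · have : -((1 - s) * x) = -(1 * x) + s * x := by ring
    rw [this, Real.exp_add]
    field_simp
  · simp

lemma ae_nonneg_expMeasure : ∀ᵐ x ∂(expMeasure 1), 0 ≤ x := by
  have h : expMeasure 1 (Set.Iio 0) = 0 := by
    rw [← lintegral_indicator_one measurableSet_Iio,
      lintegral_expMeasure_one (measurable_one.indicator measurableSet_Iio)]
    rw [lintegral_eq_zero_iff]
    · filter_upwards with x
      by_cases hx : x < 0
      · simp [exponentialPDF_of_neg hx]
      · simp [hx]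
    · exact ((measurable_exponentialPDFReal 1).ennreal_ofReal).mul
        (measurable_one.indicator measurableSet_Iio)
  rw [ae_iff]
  simpa [Set.Iio] using h

lemma expMeasure_Ici {x : ℝ} (hx : 0 ≤ x) :
    ENNReal.ofReal (Real.exp (-x)) ≤ expMeasure 1 (Set.Ici x) := by
  have := isProbabilityMeasure_expMeasure one_pos
  have h1 : expMeasure 1 (Set.Iic x) = ENNReal.ofReal (1 - Real.exp (-x)) := by
    rw [← ofReal_cdf, cdf_expMeasure_eq one_pos, if_pos hx, one_mul]
  have h2 : (Set.Iic x)ᶜ ⊆ Set.Ici x := by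
    intro y hy
    simp at hy ⊢
    exact hy.le
  refine le_trans ?_ (measure_mono h2)
  rw [prob_compl_eq_one_sub measurableSet_Iic, h1, ← ENNReal.ofReal_one,
    ← ENNReal.ofReal_sub _ (by simpa using hx)]
  simp

lemma le_lintegral_rpow_expMeasure {p : ℝ} (hp : 0 < p) :
    ENNReal.ofReal (p * Real.exp (-1)) ^ p ≤ ∫⁻ x, ENNReal.ofReal x ^ p ∂(expMeasure 1) := by
  have h1 : ENNReal.ofReal (p * Real.exp (-1)) ^ p
      = ENNReal.ofReal p ^ p * ENNReal.ofReal (Real.exp (-p)) := by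
    rw [ENNReal.ofReal_mul hp.le, ENNReal.mul_rpow_of_nonneg _ _ hp.le,
      ENNReal.ofReal_rpow_of_pos (Real.exp_pos _), ← Real.exp_mul]
    simp
  rw [h1]
  refine le_trans (mul_le_mul_right (expMeasure_Ici hp.le) _) ?_
  refine le_trans (mul_le_mul_right (measure_mono ?_) _)
    (mul_meas_ge_le_lintegral₀ (by fun_prop) _)
  intro x hx
  simp only [Set.mem_Ici] at hx
  exact ENNReal.rpow_le_rpow (ENNReal.ofReal_le_ofReal hx) hp.le

section Setting

variable {Ω : Type*} [MeasurableSpace Ω] {μ : Measure Ω} {α : ℝ} {κ θ : ℕ → Ω → ℝ}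

namespace IsMixtureSetting

lemma ae_theta_nonneg (h : IsMixtureSetting μ α κ θ) : ∀ᵐ ω ∂μ, ∀ n, 0 ≤ θ n ω := by
  rw [ae_all_iff]
  intro n
  have := ae_nonneg_expMeasure
  rw [← h.law_theta n] at this
  exact ae_of_ae_map (h.measurable_theta n).aemeasurable this

lemma ae_kappa [IsProbabilityMeasure μ] (h : IsMixtureSetting μ α κ θ) (h0 : 0 ≤ α)
    (h1 : α < 1) :
    ∀ᵐ ω ∂μ, ∀ n, κ n ω = 0 ∨ κ n ω = 1 := by
  rw [ae_all_iff]
  intro n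
  have m0 : MeasurableSet {ω | κ n ω = 0} := h.measurable_kappa n (measurableSet_singleton 0)
  have m1 : MeasurableSet {ω | κ n ω = 1} := h.measurable_kappa n (measurableSet_singleton 1)
  have hd : Disjoint {ω | κ n ω = 0} {ω | κ n ω = 1} := by
    rw [Set.disjoint_left]
    intro ω (hω : κ n ω = 0) (hω' : κ n ω = 1)
    simp [hω] at hω'
  refine (mem_ae_iff_prob_eq_one (m0.union m1)).2 ?_
  rw [measure_union hd m1, h.prob_kappa_zero, h.prob_kappa_one,
    ← ENNReal.ofReal_add h0 (by linarith)]
  simp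

lemma lintegral_comp_theta (h : IsMixtureSetting μ α κ θ) (n : ℕ) {g : ℝ → ENNReal}
    (hg : Measurable g) : ∫⁻ ω, g (θ n ω) ∂μ = ∫⁻ x, g x ∂(expMeasure 1) := by
  rw [← h.law_theta n, lintegral_map hg (h.measurable_theta n)]

lemma lintegral_comp_kappa [IsProbabilityMeasure μ] (h : IsMixtureSetting μ α κ θ) (h0 : 0 ≤ α)
    (h1 : α < 1) (n : ℕ) (g : ℝ → ENNReal) :
    ∫⁻ ω, g (κ n ω) ∂μ = ENNReal.ofReal α * g 0 + ENNReal.ofReal (1 - α) * g 1 := by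
  have m0 : MeasurableSet {ω | κ n ω = 0} := h.measurable_kappa n (measurableSet_singleton 0)
  have m1 : MeasurableSet {ω | κ n ω = 1} := h.measurable_kappa n (measurableSet_singleton 1)
  have e : ∀ᵐ ω ∂μ, g (κ n ω) = {ω | κ n ω = 0}.indicator (fun _ => g 0) ω
      + {ω | κ n ω = 1}.indicator (fun _ => g 1) ω := by
    filter_upwards [h.ae_kappa h0 h1] with ω hω
    rcases hω n with hω | hω <;> simp [hω]
  rw [lintegral_congr_ae e, lintegral_add_left (measurable_const.indicator m0),
    lintegral_indicator_const m0, lintegral_indicator_const m1, h.prob_kappa_zero,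
    h.prob_kappa_one, mul_comm, mul_comm (g 1)]

lemma indepFun_kappa_theta (h : IsMixtureSetting μ α κ θ) (n : ℕ) : IndepFun (κ n) (θ n) μ :=
  h.indep.indepFun (i := Sum.inl n) (j := Sum.inr n) (by simp)

lemma lintegral_mul_kappa_theta [IsProbabilityMeasure μ] (h : IsMixtureSetting μ α κ θ)
    (h0 : 0 ≤ α) (h1 : α < 1) (n : ℕ) {v g : ℝ → ENNReal} (hv : Measurable v)
    (hg : Measurable g) :
    ∫⁻ ω, v (κ n ω) * g (θ n ω) ∂μ
      = (ENNReal.ofReal α * v 0 + ENNReal.ofReal (1 - α) * v 1) * ∫⁻ x, g x ∂(expMeasure 1) := by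
  rw [← h.lintegral_comp_kappa h0 h1 n, ← h.lintegral_comp_theta n hg]
  exact lintegral_mul_eq_lintegral_mul_lintegral_of_indepFun
    (hv.comp (h.measurable_kappa n)) (hg.comp (h.measurable_theta n))
    ((h.indepFun_kappa_theta n).comp hv hg)

lemma measurable_factor (h : IsMixtureSetting μ α κ θ) {f : ℝ × ℝ → ENNReal}
    (hf : Measurable f) (m : ℕ) : Measurable fun ω => f (κ m ω, θ m ω) :=
  hf.comp ((h.measurable_kappa m).prodMk (h.measurable_theta m))

lemma lintegral_prod_factor [IsProbabilityMeasure μ] (h : IsMixtureSetting μ α κ θ)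
    {f : ℕ → ℝ × ℝ → ENNReal} (hf : ∀ m, Measurable (f m)) (N : ℕ) :
    ∫⁻ ω, ∏ m ∈ Finset.range N, f m (κ m ω, θ m ω) ∂μ
      = ∏ m ∈ Finset.range N, ∫⁻ ω, f m (κ m ω, θ m ω) ∂μ := by
  induction N with
  | zero => simp
  | succ N ih =>
    simp only [Finset.prod_range_succ, ← ih]
    refine lintegral_mul_eq_lintegral_mul_lintegral_of_indepFun
      (Finset.measurable_prod _ fun m _ => h.measurable_factor (hf m) m)
      (h.measurable_factor (hf N) N) ?_
    have hm : ∀ i, Measurable (Sum.elim κ θ i) := by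
      rintro (i | i)
      exacts [h.measurable_kappa i, h.measurable_theta i]
    have hi := h.indep.indepFun_finset ((Finset.range N).disjSum (Finset.range N))
      ({Sum.inl N, Sum.inr N} : Finset (ℕ ⊕ ℕ)) (by
        rw [Finset.disjoint_left]
        rintro (i | i) <;> simp <;> omega) hm
    have := hi.comp
      (φ := fun v => ∏ m ∈ (Finset.range N).attach,
        f m.1 (v ⟨Sum.inl m.1, Finset.inl_mem_disjSum.2 m.2⟩,
          v ⟨Sum.inr m.1, Finset.inr_mem_disjSum.2 m.2⟩))
      (ψ := fun v => f N (v ⟨Sum.inl N, by simp⟩, v ⟨Sum.inr N, by simp⟩))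
      (Finset.measurable_prod _ fun m _ =>
        (hf m.1).comp ((measurable_pi_apply _).prodMk (measurable_pi_apply _)))
      ((hf N).comp ((measurable_pi_apply _).prodMk (measurable_pi_apply _)))
    convert! this using 1
    ext ω
    simp only [Function.comp, Sum.elim_inl, Sum.elim_inr]
    exact (Finset.prod_attach (Finset.range N) fun m => f m (κ m ω, θ m ω)).symm

end IsMixtureSetting
end Setting

lemma ofReal_rpow_le_exp {x B p : ℝ} (hB : 0 < B) (hp : 0 < p) :
    ENNReal.ofReal x ^ p
      ≤ ENNReal.ofReal B ^ p * ENNReal.ofReal (Real.exp (-p))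
        * ENNReal.ofReal (Real.exp (p / B * x)) := by
  have h1 : x ≤ B * (Real.exp (-1) * Real.exp (x / B)) := by
    rw [← Real.exp_add]
    have := Real.add_one_le_exp (-1 + x / B)
    calc x = B * (-1 + x / B + 1) := by field_simp; ring
      _ ≤ _ := mul_le_mul_of_nonneg_left this hB.le
  refine (ENNReal.rpow_le_rpow (ENNReal.ofReal_le_ofReal h1) hp.le).trans (le_of_eq ?_)
  rw [ENNReal.ofReal_mul hB.le, ENNReal.ofReal_mul (Real.exp_pos _).le,
    ENNReal.mul_rpow_of_nonneg _ _ hp.le, ENNReal.mul_rpow_of_nonneg _ _ hp.le,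
    ENNReal.ofReal_rpow_of_pos (Real.exp_pos _), ENNReal.ofReal_rpow_of_pos (Real.exp_pos _),
    ← Real.exp_mul, ← Real.exp_mul, mul_assoc]
  rw [neg_one_mul, div_mul_eq_mul_div, div_mul_eq_mul_div, mul_comm x p]

lemma lintegral_le_of_tendsto_ae {Ω : Type*} [MeasurableSpace Ω] {μ : Measure Ω}
    {F : ℕ → Ω → ENNReal} {G : Ω → ENNReal} {K : ENNReal} (hF : ∀ n, AEMeasurable (F n) μ)
    (h : ∀ᵐ ω ∂μ, Filter.Tendsto (fun n => F n ω) Filter.atTop (nhds (G ω)))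
    (hK : ∀ n, ∫⁻ ω, F n ω ∂μ ≤ K) : ∫⁻ ω, G ω ∂μ ≤ K := by
  have e : ∀ᵐ ω ∂μ, G ω = Filter.liminf (fun n => F n ω) Filter.atTop := by
    filter_upwards [h] with ω hω using hω.liminf_eq.symm
  rw [lintegral_congr_ae e]
  refine (lintegral_liminf_le' hF).trans ?_
  exact Filter.liminf_le_of_le (by isBoundedDefault) fun b hb => by
    obtain ⟨n, hn⟩ := hb.exists
    exact hn.trans (hK n)

section Setting

variable {Ω : Type*} [MeasurableSpace Ω] {μ : Measure Ω} {α : ℝ} {κ θ : ℕ → Ω → ℝ}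

/-- The expectation of `v` under the Bernoulli law with mass `α` at `0` and `1 - α` at `1`. -/
noncomputable def bernoulliMean (α : ℝ) (v : ℝ → ENNReal) : ENNReal :=
  ENNReal.ofReal α * v 0 + ENNReal.ofReal (1 - α) * v 1

lemma bernoulliMean_one (h0 : 0 ≤ α) (h1 : α < 1) : bernoulliMean α 1 = 1 := by
  rw [bernoulliMean, Pi.one_apply, Pi.one_apply, mul_one, mul_one,
    ← ENNReal.ofReal_add h0 (by linarith)]
  simp

lemma bernoulliMean_indicator_zero :
    bernoulliMean α (Set.indicator {0} 1) = ENNReal.ofReal α := by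
  simp [bernoulliMean]

lemma bernoulliMean_indicator_one :
    bernoulliMean α (Set.indicator {1} 1) = ENNReal.ofReal (1 - α) := by
  simp [bernoulliMean]

/-- The sum of `a n * θ n` and of the `k` terms that follow it in the mixture. -/
noncomputable def tailSum (a : ℕ → ℝ) (κ θ : ℕ → Ω → ℝ) (n k : ℕ) (ω : Ω) : ℝ :=
  a n * θ n ω + ∑ m ∈ Finset.range k, a (n + 1 + m) * κ (n + 1 + m) ω * θ (n + 1 + m) ω

namespace IsMixtureSetting

lemma measurable_term (h : IsMixtureSetting μ α κ θ) (a : ℕ → ℝ) (n : ℕ) :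
    Measurable fun ω => a n * κ n ω * θ n ω :=
  ((h.measurable_kappa n).const_mul _).mul (h.measurable_theta n)

lemma measurable_tailSum (h : IsMixtureSetting μ α κ θ) (a : ℕ → ℝ) (n k : ℕ) :
    Measurable (tailSum a κ θ n k) :=
  ((h.measurable_theta n).const_mul _).add
    (Finset.measurable_sum _ fun m _ => h.measurable_term a (n + 1 + m))

lemma lintegral_exp_term_le [IsProbabilityMeasure μ] (h : IsMixtureSetting μ α κ θ)
    (h0 : 0 ≤ α) (h1 : α < 1) (n : ℕ) {s : ℝ} (hs0 : 0 ≤ s) (hs : s ≤ 1 / 2) :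
    ∫⁻ ω, ENNReal.ofReal (Real.exp (s * (κ n ω * θ n ω))) ∂μ
      ≤ ENNReal.ofReal (Real.exp (2 * s * (1 - α))) := by
  have e : ∀ᵐ ω ∂μ, ENNReal.ofReal (Real.exp (s * (κ n ω * θ n ω)))
      = Set.indicator {0} 1 (κ n ω) + Set.indicator {1} 1 (κ n ω)
        * ENNReal.ofReal (Real.exp (s * θ n ω)) := by
    filter_upwards [h.ae_kappa h0 h1] with ω hω
    rcases hω n with hω | hω <;> simp [hω]
  have m0 : Measurable (Set.indicator {0} 1 : ℝ → ENNReal) :=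
    measurable_one.indicator (measurableSet_singleton _)
  have m1 : Measurable (Set.indicator {1} 1 : ℝ → ENNReal) :=
    measurable_one.indicator (measurableSet_singleton _)
  rw [lintegral_congr_ae e,
    lintegral_add_left (f := fun ω => Set.indicator {0} 1 (κ n ω))
      (m0.comp (h.measurable_kappa n)),
    h.lintegral_comp_kappa h0 h1, h.lintegral_mul_kappa_theta h0 h1 n m1
      (g := fun x => ENNReal.ofReal (Real.exp (s * x))) (by fun_prop),
    lintegral_exp_mul_expMeasure (by linarith)]
  simp only [Set.indicator, Set.mem_singleton_iff, Pi.one_apply, if_true, zero_ne_one, one_ne_zero,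
    if_false, mul_one, mul_zero, add_zero, zero_add]
  have hs' : 0 < 1 - s := by linarith
  rw [← ENNReal.ofReal_mul (by linarith), ← ENNReal.ofReal_add h0 (by
    have : 0 ≤ 1 - α := by linarith
    positivity)]
  refine ENNReal.ofReal_le_ofReal (le_trans ?_ (Real.add_one_le_exp _))
  have h2 : 1 / (1 - s) ≤ 1 + 2 * s := by
    rw [div_le_iff₀ hs']
    nlinarith
  nlinarith

lemma lintegral_weight_mul_exp_le [IsProbabilityMeasure μ] (h : IsMixtureSetting μ α κ θ)
    (h0 : 0 ≤ α) (h1 : α < 1) {a : ℕ → ℝ} (ha : ∀ n, 0 ≤ a n) (n k : ℕ) {t : ℝ} (ht0 : 0 ≤ t)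
    (ht : ∀ m, n ≤ m → t * a m ≤ 1 / 2) {w v : ℝ → ENNReal} (hw : Measurable w)
    (hv : Measurable v) :
    ∫⁻ ω, (∏ m ∈ Finset.range n, w (κ m ω)) * v (κ n ω)
        * ENNReal.ofReal (Real.exp (t * tailSum a κ θ n k ω)) ∂μ
      ≤ bernoulliMean α w ^ n * bernoulliMean α v * 2
        * ENNReal.ofReal (Real.exp (2 * t * ((1 - α) * ∑ m ∈ Finset.range k, a (n + 1 + m)))) := by
  let f : ℕ → ℝ × ℝ → ENNReal := fun m x =>
    if m < n then w x.1
    else if m = n then v x.1 * ENNReal.ofReal (Real.exp (t * a m * x.2))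
    else ENNReal.ofReal (Real.exp (t * a m * (x.1 * x.2)))
  have hf : ∀ m, Measurable (f m) := by
    intro m
    by_cases h1 : m < n
    · simp only [f, h1, if_true]
      exact hw.comp measurable_fst
    by_cases h2 : m = n
    · simp only [f, h2, lt_irrefl, if_false, if_true]
      exact (hv.comp measurable_fst).mul (by fun_prop)
    · simp only [f, h1, h2, if_false]
      fun_prop
  have flt : ∀ m ∈ Finset.range n, ∀ x, f m x = w x.1 := fun m hm x => by
    simp [f, Finset.mem_range.1 hm]
  have feq : ∀ x, f n x = v x.1 * ENNReal.ofReal (Real.exp (t * a n * x.2)) := fun x => by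
    simp [f]
  have fgt : ∀ m x, f (n + 1 + m) x
      = ENNReal.ofReal (Real.exp (t * a (n + 1 + m) * (x.1 * x.2))) := fun m x => by
    have h1 : ¬ n + 1 + m < n := by omega
    have h2 : ¬ n + 1 + m = n := by omega
    simp only [f, h1, h2, if_false]
  have e : ∀ ω, (∏ m ∈ Finset.range n, w (κ m ω)) * v (κ n ω)
        * ENNReal.ofReal (Real.exp (t * tailSum a κ θ n k ω))
      = ∏ m ∈ Finset.range (n + 1 + k), f m (κ m ω, θ m ω) := by
    intro ω
    rw [Finset.prod_range_add, Finset.prod_range_succ, feq,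
      Finset.prod_congr rfl fun m hm => flt m hm _, Finset.prod_congr rfl fun m _ => fgt m _,
      ← ENNReal.ofReal_prod_of_nonneg fun _ _ => (Real.exp_pos _).le, ← Real.exp_sum, tailSum,
      mul_add, Real.exp_add, ENNReal.ofReal_mul (Real.exp_pos _).le, Finset.mul_sum]
    simp only [mul_assoc]
  simp only [e]
  rw [h.lintegral_prod_factor hf, Finset.prod_range_add, Finset.prod_range_succ]
  have b1 : ∏ m ∈ Finset.range n, ∫⁻ ω, f m (κ m ω, θ m ω) ∂μ = bernoulliMean α w ^ n := by
    rw [Finset.prod_congr rfl fun m hm => by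
      simp only [flt m hm]; exact h.lintegral_comp_kappa h0 h1 m w]
    simp [bernoulliMean]
  have b2 : ∫⁻ ω, f n (κ n ω, θ n ω) ∂μ ≤ bernoulliMean α v * 2 := by
    simp only [feq]
    rw [h.lintegral_mul_kappa_theta h0 h1 n hv
      (g := fun x => ENNReal.ofReal (Real.exp (t * a n * x))) (by fun_prop),
      lintegral_exp_mul_expMeasure (by linarith [ht n le_rfl])]
    refine mul_le_mul_right ?_ _
    rw [← ENNReal.ofReal_ofNat]
    refine ENNReal.ofReal_le_ofReal ?_
    rw [div_le_iff₀] <;> linarith [ht n le_rfl]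
  have b3 : ∏ m ∈ Finset.range k, ∫⁻ ω, f (n + 1 + m) (κ (n + 1 + m) ω, θ (n + 1 + m) ω) ∂μ
      ≤ ENNReal.ofReal
        (Real.exp (2 * t * ((1 - α) * ∑ m ∈ Finset.range k, a (n + 1 + m)))) := by
    rw [Finset.mul_sum, Finset.mul_sum, Real.exp_sum,
      ENNReal.ofReal_prod_of_nonneg fun _ _ => (Real.exp_pos _).le]
    refine Finset.prod_le_prod' fun m _ => ?_
    simp only [fgt]
    refine (h.lintegral_exp_term_le h0 h1 _ (mul_nonneg ht0 (ha _))
      (ht _ (by omega))).trans (le_of_eq ?_)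
    congr 2
    ring
  rw [b1]
  calc _ ≤ bernoulliMean α w ^ n * (bernoulliMean α v * 2) * _ :=
        mul_le_mul' (mul_le_mul_right b2 _) b3
    _ = _ := by ring

lemma lintegral_weight_mul_rpow_le [IsProbabilityMeasure μ] (h : IsMixtureSetting μ α κ θ)
    (h0 : 0 ≤ α) (h1 : α < 1) {a : ℕ → ℝ} (ha : ∀ n, 0 ≤ a n) (hanti : Antitone a) (n k : ℕ)
    {p S : ℝ} (hp : 0 < p) (hS : ∑ m ∈ Finset.range k, a (n + 1 + m) ≤ S)
    {w v : ℝ → ENNReal} (hw : Measurable w) (hv : Measurable v) :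
    ∫⁻ ω, (∏ m ∈ Finset.range n, w (κ m ω)) * v (κ n ω)
        * ENNReal.ofReal (tailSum a κ θ n k ω) ^ p ∂μ
      ≤ bernoulliMean α w ^ n * bernoulliMean α v * 2
        * ENNReal.ofReal (2 * (p * a n + (1 - α) * S)) ^ p := by
  have hq : 0 < 1 - α := by linarith
  have hS0 : 0 ≤ S := (Finset.sum_nonneg fun m _ => ha _).trans hS
  rcases (ha n).eq_or_lt with han | han
  · have hz : ∀ m, n ≤ m → a m = 0 := fun m hm => le_antisymm ((hanti hm).trans han.ge) (ha m)
    have : ∀ ω, tailSum a κ θ n k ω = 0 := by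
      intro ω
      rw [tailSum, hz n le_rfl, Finset.sum_eq_zero fun m _ => by rw [hz _ (by omega)]; ring]
      ring
    simp [this, hp]
  set B := p * a n + (1 - α) * S with hB
  have hBpos : 0 < B := by positivity
  have ht : ∀ m, n ≤ m → p / (2 * B) * a m ≤ 1 / 2 := by
    intro m hm
    have h2 : p * a m ≤ B := by
      have := mul_le_mul_of_nonneg_left (hanti hm) hp.le
      have : 0 ≤ (1 - α) * S := by positivity
      linarith
    rw [div_mul_eq_mul_div, div_le_iff₀ (by positivity)]
    linarith
  have mW : Measurable fun ω => (∏ m ∈ Finset.range n, w (κ m ω)) * v (κ n ω) :=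
    (Finset.measurable_prod _ fun m _ => hw.comp (h.measurable_kappa m)).mul
      (hv.comp (h.measurable_kappa n))
  calc _ ≤ ∫⁻ ω, ENNReal.ofReal (2 * B) ^ p * ENNReal.ofReal (Real.exp (-p)) *
          ((∏ m ∈ Finset.range n, w (κ m ω)) * v (κ n ω)
        * ENNReal.ofReal (Real.exp (p / (2 * B) * tailSum a κ θ n k ω))) ∂μ := by
        refine lintegral_mono fun ω => ?_
        refine (mul_le_mul_right (ofReal_rpow_le_exp (B := 2 * B) (by positivity) hp)
          _).trans (le_of_eq ?_)
        ring
    _ = ENNReal.ofReal (2 * B) ^ p * ENNReal.ofReal (Real.exp (-p)) *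
          ∫⁻ ω, ((∏ m ∈ Finset.range n, w (κ m ω)) * v (κ n ω)
        * ENNReal.ofReal (Real.exp (p / (2 * B) * tailSum a κ θ n k ω))) ∂μ :=
        lintegral_const_mul _ (mW.mul
          ((Real.measurable_exp.comp ((h.measurable_tailSum a n k).const_mul _)).ennreal_ofReal))
    _ ≤ ENNReal.ofReal (2 * B) ^ p * ENNReal.ofReal (Real.exp (-p)) *
          (bernoulliMean α w ^ n * bernoulliMean α v * 2 * ENNReal.ofReal (Real.exp p)) := by
        refine mul_le_mul_right ((h.lintegral_weight_mul_exp_le h0 h1 ha n k (by positivity) ht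
          hw hv).trans (mul_le_mul_right (ENNReal.ofReal_le_ofReal (Real.exp_le_exp.2 ?_)) _)) _
        have h3 : (1 - α) * ∑ m ∈ Finset.range k, a (n + 1 + m) ≤ B :=
          (mul_le_mul_of_nonneg_left hS hq.le).trans (by
            have : 0 ≤ p * a n := by positivity
            linarith)
        calc 2 * (p / (2 * B)) * ((1 - α) * ∑ m ∈ Finset.range k, a (n + 1 + m))
            ≤ 2 * (p / (2 * B)) * B := mul_le_mul_of_nonneg_left h3 (by positivity)
          _ = p := by field_simp
    _ = bernoulliMean α w ^ n * bernoulliMean α v * 2 * ENNReal.ofReal (2 * B) ^ p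
          * (ENNReal.ofReal (Real.exp (-p)) * ENNReal.ofReal (Real.exp p)) := by ring
    _ = _ := by
        rw [← ENNReal.ofReal_mul (Real.exp_pos _).le, ← Real.exp_add]
        simp

end IsMixtureSetting
end Setting

lemma lintegral_ofReal_expMeasure_lt_top :
    ∫⁻ x, ENNReal.ofReal x ∂(expMeasure 1) < ⊤ := by
  have h : ∀ x : ℝ, ENNReal.ofReal x ≤ 2 * ENNReal.ofReal (Real.exp (1 / 2 * x)) := by
    intro x
    rw [← ENNReal.ofReal_ofNat, ← ENNReal.ofReal_mul (by norm_num)]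
    refine ENNReal.ofReal_le_ofReal ?_
    linarith [Real.add_one_le_exp (1 / 2 * x)]
  refine (lintegral_mono h).trans_lt ?_
  rw [lintegral_const_mul _ (by fun_prop), lintegral_exp_mul_expMeasure (by norm_num)]
  exact ENNReal.mul_lt_top (by simp) ENNReal.ofReal_lt_top

/-- Two-sided bounds for the `p`-norm of a nonnegative variable from bounds on its `p`-th moment
and its mean. -/
lemma memLp_and_eLpNorm_bounds {Ω : Type*} [MeasurableSpace Ω] {μ : Measure Ω}
    [IsProbabilityMeasure μ] {Y : Ω → ℝ} (hY : AEMeasurable Y μ) (hY0 : ∀ᵐ ω ∂μ, 0 ≤ Y ω)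
    {p U V : ℝ} (hp : 1 ≤ p) (hU : 0 ≤ U) (hV : 0 ≤ V)
    (hle : ∫⁻ ω, ENNReal.ofReal (Y ω) ^ p ∂μ ≤ ENNReal.ofReal (4 * (U + V)) ^ p)
    (hgeU : ENNReal.ofReal (Real.exp (-1) * U) ^ p ≤ ∫⁻ ω, ENNReal.ofReal (Y ω) ^ p ∂μ)
    (hgeV : ENNReal.ofReal (Real.exp (-1) * V) ≤ ∫⁻ ω, ENNReal.ofReal (Y ω) ∂μ) :
    MemLp Y (ENNReal.ofReal p) μ ∧
      Real.exp (-1) / 2 * (U + V) ≤ (eLpNorm Y (ENNReal.ofReal p) μ).toReal ∧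
      (eLpNorm Y (ENNReal.ofReal p) μ).toReal ≤ 4 * (U + V) := by
  have hp0 : 0 < p := by linarith
  have hn : ∀ᵐ ω ∂μ, ‖Y ω‖ₑ = ENNReal.ofReal (Y ω) := by
    filter_upwards [hY0] with ω hω using Real.enorm_of_nonneg hω
  have hnorm : eLpNorm Y (ENNReal.ofReal p) μ
      = (∫⁻ ω, ENNReal.ofReal (Y ω) ^ p ∂μ) ^ (1 / p) := by
    rw [eLpNorm_eq_lintegral_rpow_enorm_toReal (by simpa using hp0) ENNReal.ofReal_ne_top,
      ENNReal.toReal_ofReal hp0.le]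
    congr 1
    refine lintegral_congr_ae ?_
    filter_upwards [hn] with ω hω
    rw [hω]
  have hnorm1 : eLpNorm Y 1 μ = ∫⁻ ω, ENNReal.ofReal (Y ω) ∂μ := by
    rw [eLpNorm_one_eq_lintegral_enorm]
    exact lintegral_congr_ae hn
  have hinv : ∀ x : ENNReal, (x ^ p) ^ (1 / p) = x := fun x => by
    rw [one_div, ENNReal.rpow_rpow_inv hp0.ne']
  have upper : eLpNorm Y (ENNReal.ofReal p) μ ≤ ENNReal.ofReal (4 * (U + V)) := by
    rw [hnorm, ← hinv (ENNReal.ofReal (4 * (U + V)))]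
    exact ENNReal.rpow_le_rpow hle (by positivity)
  have lowerU : ENNReal.ofReal (Real.exp (-1) * U) ≤ eLpNorm Y (ENNReal.ofReal p) μ := by
    rw [hnorm, ← hinv (ENNReal.ofReal (Real.exp (-1) * U))]
    exact ENNReal.rpow_le_rpow hgeU (by positivity)
  have lowerV : ENNReal.ofReal (Real.exp (-1) * V) ≤ eLpNorm Y (ENNReal.ofReal p) μ := by
    rw [← hnorm1] at hgeV
    refine hgeV.trans (eLpNorm_le_eLpNorm_of_exponent_le ?_ hY.aestronglyMeasurable)
    simpa using hp
  have hfin : eLpNorm Y (ENNReal.ofReal p) μ < ⊤ := upper.trans_lt ENNReal.ofReal_lt_top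
  refine ⟨⟨hY.aestronglyMeasurable, hfin⟩, ?_, ENNReal.toReal_le_of_le_ofReal (by positivity) upper⟩
  have h1 := (ENNReal.ofReal_le_iff_le_toReal hfin.ne).1 lowerU
  have h2 := (ENNReal.ofReal_le_iff_le_toReal hfin.ne).1 lowerV
  linarith

section Setting

variable {Ω : Type*} {κ θ : ℕ → Ω → ℝ}

/-- The indicator of the event that `n` is the first index with `κ n = 1`. -/
noncomputable def firstOne (κ : ℕ → Ω → ℝ) (n : ℕ) (ω : Ω) : ENNReal :=
  (∏ m ∈ Finset.range n, Set.indicator {0} 1 (κ m ω)) * Set.indicator {1} 1 (κ n ω)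

lemma firstOne_eq_one {n : ℕ} {ω : Ω} (hn : κ n ω = 1) (hlt : ∀ m < n, κ m ω = 0) :
    firstOne κ n ω = 1 := by
  rw [firstOne, Finset.prod_eq_one fun m hm => by simp [hlt m (Finset.mem_range.1 hm)]]
  simp [hn]

lemma firstOne_eq_zero_of_ne {n : ℕ} {ω : Ω} (hn : κ n ω ≠ 1) : firstOne κ n ω = 0 := by
  simp [firstOne, hn]

lemma firstOne_eq_zero_of_lt {m n : ℕ} {ω : Ω} (hmn : m < n) (hm : κ m ω = 1) :
    firstOne κ n ω = 0 := by
  rw [firstOne, Finset.prod_eq_zero (Finset.mem_range.2 hmn) (by simp [hm]), zero_mul]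

lemma exists_first_one {ω : Ω} (hκ : ∀ n, κ n ω = 0 ∨ κ n ω = 1) (hex : ∃ n, κ n ω = 1) :
    ∃ n, κ n ω = 1 ∧ ∀ m < n, κ m ω = 0 := by
  classical
  exact ⟨Nat.find hex, Nat.find_spec hex, fun m hm => (hκ m).resolve_right (Nat.find_min hex hm)⟩

lemma sum_range_rpow_le_sum_firstOne {a : ℕ → ℝ} {ω : Ω} (hκ : ∀ n, κ n ω = 0 ∨ κ n ω = 1) {p : ℝ}
    (hp : 0 < p) (N : ℕ) :
    ENNReal.ofReal (∑ m ∈ Finset.range N, a m * κ m ω * θ m ω) ^ p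
      ≤ ∑ n ∈ Finset.range N, firstOne κ n ω
          * ENNReal.ofReal (tailSum a κ θ n (N - 1 - n) ω) ^ p := by
  by_cases hex : ∃ n < N, κ n ω = 1
  · obtain ⟨n', hn', hn1'⟩ := hex
    obtain ⟨n, hn, hlt⟩ := exists_first_one hκ ⟨n', hn1'⟩
    have hnN : n < N := by
      by_contra hc
      have := hlt n' (by omega)
      rw [hn1'] at this
      exact one_ne_zero this
    refine le_trans (le_of_eq ?_)
      (Finset.single_le_sum (fun _ _ => zero_le) (Finset.mem_range.2 hnN))
    rw [firstOne_eq_one hn hlt, one_mul, tailSum]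
    congr 2
    obtain ⟨k, rfl⟩ : ∃ k, N = n + 1 + k := ⟨N - (n + 1), by omega⟩
    have : n + 1 + k - 1 - n = k := by omega
    rw [Finset.sum_range_add, Finset.sum_range_succ, hn, this,
      Finset.sum_eq_zero fun m hm => by rw [hlt m (Finset.mem_range.1 hm)]; ring]
    ring
  · push Not at hex
    rw [Finset.sum_eq_zero fun m hm => by
      rw [(hκ m).resolve_right (hex m (Finset.mem_range.1 hm))]; ring]
    simp [hp]

lemma tsum_firstOne_le {a : ℕ → ℝ} (ha : ∀ n, 0 ≤ a n) {ω : Ω}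
    (hκ : ∀ n, κ n ω = 0 ∨ κ n ω = 1) (hθ : ∀ n, 0 ≤ θ n ω)
    (hs : Summable fun n => a n * κ n ω * θ n ω) {p : ℝ} (hp : 0 < p) :
    ∑' n, firstOne κ n ω * ENNReal.ofReal (a n * θ n ω) ^ p
      ≤ ENNReal.ofReal (mixtureSum a κ θ ω) ^ p := by
  by_cases hex : ∃ n, κ n ω = 1
  · obtain ⟨n, hn, hlt⟩ := exists_first_one hκ hex
    rw [tsum_eq_single n, firstOne_eq_one hn hlt, one_mul]
    · refine ENNReal.rpow_le_rpow (ENNReal.ofReal_le_ofReal ?_) hp.le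
      have := hs.le_tsum n fun m _ => by
        rcases hκ m with h | h <;> simp [h, mul_nonneg, ha, hθ]
      rwa [hn, mul_one] at this
    · intro m hm
      rcases lt_or_gt_of_ne hm with h | h
      · rw [firstOne_eq_zero_of_ne (by simp [hlt m h]), zero_mul]
      · rw [firstOne_eq_zero_of_lt h hn, zero_mul]
  · push Not at hex
    simp [fun n => firstOne_eq_zero_of_ne (hex n)]

variable [MeasurableSpace Ω] {μ : Measure Ω} {α : ℝ}

namespace IsMixtureSetting

lemma measurable_firstOne (h : IsMixtureSetting μ α κ θ) (n : ℕ) : Measurable (firstOne κ n) :=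
  (Finset.measurable_prod _ fun m _ =>
    (measurable_one.indicator (measurableSet_singleton _)).comp (h.measurable_kappa m)).mul
    ((measurable_one.indicator (measurableSet_singleton _)).comp (h.measurable_kappa n))

lemma lintegral_firstOne_mul [IsProbabilityMeasure μ] (h : IsMixtureSetting μ α κ θ)
    (h0 : 0 ≤ α) (h1 : α < 1) (n : ℕ) {g : ℝ → ENNReal} (hg : Measurable g) :
    ∫⁻ ω, firstOne κ n ω * g (θ n ω) ∂μ
      = ENNReal.ofReal α ^ n * ENNReal.ofReal (1 - α) * ∫⁻ x, g x ∂(expMeasure 1) := by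
  have m0 : Measurable (Set.indicator {0} 1 : ℝ → ENNReal) :=
    measurable_one.indicator (measurableSet_singleton _)
  have m1 : Measurable (Set.indicator {1} 1 : ℝ → ENNReal) :=
    measurable_one.indicator (measurableSet_singleton _)
  let f : ℕ → ℝ × ℝ → ENNReal := fun m x =>
    if m < n then Set.indicator {0} 1 x.1 else Set.indicator {1} 1 x.1 * g x.2
  have hf : ∀ m, Measurable (f m) := by
    intro m
    by_cases h1 : m < n
    · simp only [f, h1, if_true]
      exact m0.comp measurable_fst
    · simp only [f, h1, if_false]
      exact (m1.comp measurable_fst).mul (hg.comp measurable_snd)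
  have flt : ∀ m ∈ Finset.range n, ∀ x, f m x = Set.indicator {0} 1 x.1 := fun m hm x => by
    simp only [f, Finset.mem_range.1 hm, if_true]
  have feq : ∀ x, f n x = Set.indicator {1} 1 x.1 * g x.2 := fun x => by
    simp only [f, lt_irrefl, if_false]
  have e : ∀ ω, firstOne κ n ω * g (θ n ω)
      = ∏ m ∈ Finset.range (n + 1), f m (κ m ω, θ m ω) := by
    intro ω
    rw [Finset.prod_range_succ, feq, Finset.prod_congr rfl fun m hm => flt m hm _, firstOne,
      mul_assoc]
  simp only [e]
  rw [h.lintegral_prod_factor hf, Finset.prod_range_succ]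
  simp only [feq]
  rw [h.lintegral_mul_kappa_theta h0 h1 n m1 hg, Finset.prod_congr rfl fun m hm => by
    simp only [flt m hm]; exact h.lintegral_comp_kappa h0 h1 m _]
  simp [mul_assoc]

lemma lintegral_term [IsProbabilityMeasure μ] (h : IsMixtureSetting μ α κ θ)
    (h0 : 0 ≤ α) (h1 : α < 1) {b : ℝ} (hb : 0 ≤ b) (n : ℕ) :
    ∫⁻ ω, ENNReal.ofReal (b * κ n ω * θ n ω) ∂μ
      = ENNReal.ofReal b * (ENNReal.ofReal (1 - α)
        * ∫⁻ x, ENNReal.ofReal x ∂(expMeasure 1)) := by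
  have e : ∀ᵐ ω ∂μ, ENNReal.ofReal (b * κ n ω * θ n ω)
      = ENNReal.ofReal b * (ENNReal.ofReal (κ n ω) * ENNReal.ofReal (θ n ω)) := by
    filter_upwards [h.ae_kappa h0 h1] with ω hω
    have hk : 0 ≤ κ n ω := by rcases hω n with hω | hω <;> simp [hω]
    rw [mul_assoc, ENNReal.ofReal_mul hb, ENNReal.ofReal_mul hk]
  have m : Measurable fun ω => ENNReal.ofReal (κ n ω) * ENNReal.ofReal (θ n ω) :=
    (h.measurable_kappa n).ennreal_ofReal.mul (h.measurable_theta n).ennreal_ofReal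
  rw [lintegral_congr_ae e, lintegral_const_mul _ m,
    h.lintegral_mul_kappa_theta h0 h1 n (v := ENNReal.ofReal) (g := ENNReal.ofReal)
      (by fun_prop) (by fun_prop)]
  simp

lemma lintegral_tsum_term [IsProbabilityMeasure μ] (h : IsMixtureSetting μ α κ θ)
    (h0 : 0 ≤ α) (h1 : α < 1) {b : ℕ → ℝ} (hb : ∀ n, 0 ≤ b n) (hsum : Summable b) (j : ℕ → ℕ) :
    ∫⁻ ω, ∑' n, ENNReal.ofReal (b n * κ (j n) ω * θ (j n) ω) ∂μ
      = ENNReal.ofReal (∑' n, b n) * (ENNReal.ofReal (1 - α)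
        * ∫⁻ x, ENNReal.ofReal x ∂(expMeasure 1)) := by
  have m : ∀ n, AEMeasurable (fun ω => ENNReal.ofReal (b n * κ (j n) ω * θ (j n) ω)) μ :=
    fun n => (((h.measurable_kappa (j n)).const_mul (b n)).mul
      (h.measurable_theta (j n))).ennreal_ofReal.aemeasurable
  rw [lintegral_tsum m]
  simp only [h.lintegral_term h0 h1 (hb _)]
  rw [ENNReal.tsum_mul_right, ENNReal.ofReal_tsum_of_nonneg hb hsum]

lemma ae_summable [IsProbabilityMeasure μ] (h : IsMixtureSetting μ α κ θ)
    (h0 : 0 ≤ α) (h1 : α < 1) {a : ℕ → ℝ} (ha : ∀ n, 0 ≤ a n) (hsum : Summable a) :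
    ∀ᵐ ω ∂μ, Summable fun n => a n * κ n ω * θ n ω := by
  have hfin : ∫⁻ ω, ∑' n, ENNReal.ofReal (a n * κ n ω * θ n ω) ∂μ ≠ ⊤ := by
    refine ne_of_eq_of_ne (h.lintegral_tsum_term h0 h1 ha hsum id) ?_
    exact (ENNReal.mul_lt_top ENNReal.ofReal_lt_top (ENNReal.mul_lt_top ENNReal.ofReal_lt_top
      lintegral_ofReal_expMeasure_lt_top)).ne
  filter_upwards [ae_lt_top' (AEMeasurable.tsum fun n =>
    (h.measurable_term a n).ennreal_ofReal.aemeasurable) hfin, h.ae_kappa h0 h1,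
    h.ae_theta_nonneg] with ω h1 h2 h3
  refine (ENNReal.summable_toReal h1.ne).congr fun n => ?_
  refine ENNReal.toReal_ofReal (mul_nonneg (mul_nonneg (ha n) ?_) (h3 n))
  rcases h2 n with h | h <;> simp [h]

lemma ofReal_exp_mul_le_lintegral_tsum [IsProbabilityMeasure μ] (h : IsMixtureSetting μ α κ θ)
    (h0 : 0 ≤ α) (h1 : α < 1) {b : ℕ → ℝ} (hb : ∀ n, 0 ≤ b n) (hsum : Summable b) (j : ℕ → ℕ) :
    ENNReal.ofReal (Real.exp (-1) * ((1 - α) * ∑' n, b n))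
      ≤ ∫⁻ ω, ∑' n, ENNReal.ofReal (b n * κ (j n) ω * θ (j n) ω) ∂μ := by
  have := le_lintegral_rpow_expMeasure one_pos
  simp only [ENNReal.rpow_one, one_mul] at this
  rw [h.lintegral_tsum_term h0 h1 hb hsum, ENNReal.ofReal_mul (Real.exp_pos _).le,
    ENNReal.ofReal_mul (by linarith)]
  calc _ ≤ (∫⁻ x, ENNReal.ofReal x ∂(expMeasure 1))
          * (ENNReal.ofReal (1 - α) * ENNReal.ofReal (∑' n, b n)) := mul_le_mul_left this _
    _ = _ := by ring

end IsMixtureSetting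
end Setting

lemma two_mul_ofReal_rpow_le {x p : ℝ} (hp : 1 ≤ p) :
    2 * ENNReal.ofReal (2 * x) ^ p ≤ ENNReal.ofReal (4 * x) ^ p := by
  have h4 : (4 : ℝ) * x = 2 * (2 * x) := by ring
  rw [h4, ENNReal.ofReal_mul (by norm_num : (0 : ℝ) ≤ 2) (q := 2 * x),
    ENNReal.mul_rpow_of_nonneg _ _ (by linarith)]
  refine mul_le_mul_left ?_ _
  rw [ENNReal.ofReal_ofNat]
  simpa using ENNReal.rpow_le_rpow_of_exponent_le (x := 2) (by norm_num) hp

lemma two_mul_ofReal_add_rpow_le {x y p : ℝ} (hx : 0 ≤ x) (hy : 0 ≤ y) (hp : 1 ≤ p) :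
    2 * ENNReal.ofReal (2 * (x + y)) ^ p
      ≤ 4 ^ p * (ENNReal.ofReal x ^ p + ENNReal.ofReal y ^ p) := by
  have hp0 : 0 ≤ p := by linarith
  rw [ENNReal.ofReal_mul (by norm_num), ENNReal.ofReal_add hx hy,
    ENNReal.mul_rpow_of_nonneg _ _ hp0, ENNReal.ofReal_ofNat]
  have e : (4 : ENNReal) ^ p = 2 * 2 ^ p * 2 ^ (p - 1) := by
    have h4 : (4 : ENNReal) = 2 * 2 := by norm_num
    have h2 : (2 : ENNReal) ^ p = 2 * 2 ^ (p - 1) := by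
      have := ENNReal.rpow_add 1 (p - 1) (x := 2) (by norm_num) (by norm_num)
      rwa [add_sub_cancel, ENNReal.rpow_one] at this
    rw [h4, ENNReal.mul_rpow_of_nonneg _ _ hp0]
    conv_lhs => rw [h2]
    rw [h2]
    ring
  rw [e, ← mul_assoc, mul_assoc (2 * 2 ^ p)]
  exact mul_le_mul_right (ENNReal.rpow_add_le_mul_rpow_add_rpow _ _ hp) _

lemma sum_ofReal_pow_mul_le_one {α : ℝ} (h0 : 0 ≤ α) (N : ℕ) :
    ∑ n ∈ Finset.range N, ENNReal.ofReal α ^ n * ENNReal.ofReal (1 - α) ≤ 1 := by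
  refine (ENNReal.sum_le_tsum _).trans ?_
  rw [ENNReal.tsum_mul_right, ENNReal.tsum_geometric, ENNReal.ofReal_sub _ h0,
    ENNReal.ofReal_one]
  exact ENNReal.inv_mul_le_one _

section Setting

variable {Ω : Type*} [MeasurableSpace Ω] {μ : Measure Ω} {α : ℝ} {κ θ : ℕ → Ω → ℝ}

namespace IsMixtureSetting

lemma aemeasurable_mixtureSum [IsProbabilityMeasure μ] (h : IsMixtureSetting μ α κ θ)
    (h0 : 0 ≤ α) (h1 : α < 1) {a : ℕ → ℝ} (ha : ∀ n, 0 ≤ a n) (hsum : Summable a) :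
    AEMeasurable (mixtureSum a κ θ) μ := by
  refine aemeasurable_of_tendsto_metrizable_ae' (fun N =>
    (Finset.measurable_sum (Finset.range N) fun m _ => h.measurable_term a m).aemeasurable) ?_
  filter_upwards [h.ae_summable h0 h1 ha hsum] with ω hω using hω.hasSum.tendsto_sum_nat

lemma ae_tendsto_tailSum [IsProbabilityMeasure μ] (h : IsMixtureSetting μ α κ θ)
    (h0 : 0 ≤ α) (h1 : α < 1) {a : ℕ → ℝ} (ha : ∀ n, 0 ≤ a n) (hsum : Summable a) :
    ∀ᵐ ω ∂μ, Filter.Tendsto (fun k => tailSum a κ θ 0 k ω) Filter.atTop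
      (nhds (mixtureSigma a κ θ ω)) := by
  filter_upwards [h.ae_summable h0 h1 ha hsum] with ω hω
  have := ((summable_nat_add_iff 1).2 hω).hasSum.tendsto_sum_nat
  have h2 := this.const_add (a 0 * θ 0 ω)
  refine h2.congr fun k => ?_
  simp only [tailSum, zero_add, add_comm 1]

lemma aemeasurable_mixtureSigma [IsProbabilityMeasure μ] (h : IsMixtureSetting μ α κ θ)
    (h0 : 0 ≤ α) (h1 : α < 1) {a : ℕ → ℝ} (ha : ∀ n, 0 ≤ a n) (hsum : Summable a) :
    AEMeasurable (mixtureSigma a κ θ) μ :=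
  aemeasurable_of_tendsto_metrizable_ae' (fun k => (h.measurable_tailSum a 0 k).aemeasurable)
    (h.ae_tendsto_tailSum h0 h1 ha hsum)

lemma lintegral_mixtureSigma_rpow_le [IsProbabilityMeasure μ] (h : IsMixtureSetting μ α κ θ)
    (h0 : 0 ≤ α) (h1 : α < 1) {a : ℕ → ℝ} (ha : ∀ n, 0 ≤ a n) (hanti : Antitone a)
    (hsum : Summable a) {p : ℝ} (hp : 1 ≤ p) :
    ∫⁻ ω, ENNReal.ofReal (mixtureSigma a κ θ ω) ^ p ∂μ
      ≤ ENNReal.ofReal (4 * (p * a 0 + (1 - α) * ∑' n, a (n + 1))) ^ p := by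
  refine lintegral_le_of_tendsto_ae
    (fun k => ((h.measurable_tailSum a 0 k).ennreal_ofReal.pow_const p).aemeasurable) ?_ fun k => ?_
  · filter_upwards [h.ae_tendsto_tailSum h0 h1 ha hsum] with ω hω
    exact (ENNReal.tendsto_ofReal hω).ennrpow_const p
  · have hS : ∑ m ∈ Finset.range k, a (0 + 1 + m) ≤ ∑' n, a (n + 1) := by
      simp only [zero_add, add_comm 1]
      exact ((summable_nat_add_iff 1).2 hsum).sum_le_tsum _ fun m _ => ha _
    have := h.lintegral_weight_mul_rpow_le h0 h1 ha hanti 0 k (p := p) (by linarith) hS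
      (w := 1) (v := 1) measurable_one measurable_one
    simp only [Finset.range_zero, Finset.prod_empty, Pi.one_apply, one_mul, pow_zero,
      bernoulliMean_one h0 h1] at this
    exact this.trans (two_mul_ofReal_rpow_le hp)

lemma le_lintegral_mixtureSigma_rpow [IsProbabilityMeasure μ] (h : IsMixtureSetting μ α κ θ)
    (h0 : 0 ≤ α) (h1 : α < 1) {a : ℕ → ℝ} (ha : ∀ n, 0 ≤ a n) {p : ℝ} (hp : 0 < p) :
    ENNReal.ofReal (Real.exp (-1) * (p * a 0)) ^ p
      ≤ ∫⁻ ω, ENNReal.ofReal (mixtureSigma a κ θ ω) ^ p ∂μ := by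
  have e : Real.exp (-1) * (p * a 0) = a 0 * (p * Real.exp (-1)) := by ring
  rw [e, ENNReal.ofReal_mul (ha 0), ENNReal.mul_rpow_of_nonneg _ _ hp.le]
  refine (mul_le_mul_right (le_lintegral_rpow_expMeasure hp) _).trans ?_
  rw [← h.lintegral_comp_theta 0 (g := fun x => ENNReal.ofReal x ^ p) (by fun_prop),
    ← lintegral_const_mul _ ((h.measurable_theta 0).ennreal_ofReal.pow_const p)]
  refine lintegral_mono_ae ?_
  filter_upwards [h.ae_kappa h0 h1, h.ae_theta_nonneg] with ω hκ hθ
  rw [← ENNReal.mul_rpow_of_nonneg _ _ hp.le, ← ENNReal.ofReal_mul (ha 0)]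
  refine ENNReal.rpow_le_rpow (ENNReal.ofReal_le_ofReal ?_) hp.le
  refine le_add_of_nonneg_right (tsum_nonneg fun m => mul_nonneg (mul_nonneg (ha _) ?_) (hθ _))
  rcases hκ (m + 1) with h | h <;> simp [h]

lemma lintegral_mixtureSum_rpow_le [IsProbabilityMeasure μ] (h : IsMixtureSetting μ α κ θ)
    (h0 : 0 ≤ α) (h1 : α < 1) {a : ℕ → ℝ} (ha : ∀ n, 0 ≤ a n) (hanti : Antitone a)
    (hsum : Summable a) {p : ℝ} (hp : 1 ≤ p) :
    ∫⁻ ω, ENNReal.ofReal (mixtureSum a κ θ ω) ^ p ∂μ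
      ≤ 4 ^ p * (ENNReal.ofReal p ^ p * ENNReal.ofReal (1 - α)
          * ∑' n, ENNReal.ofReal α ^ n * ENNReal.ofReal (a n) ^ p
        + ENNReal.ofReal ((1 - α) * ∑' n, a n) ^ p) := by
  have hp0 : 0 < p := by linarith
  have mterm : ∀ n k, Measurable fun ω =>
      firstOne κ n ω * ENNReal.ofReal (tailSum a κ θ n k ω) ^ p := fun n k =>
    (h.measurable_firstOne n).mul ((h.measurable_tailSum a n k).ennreal_ofReal.pow_const p)
  have m0 : Measurable (Set.indicator {0} 1 : ℝ → ENNReal) :=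
    measurable_one.indicator (measurableSet_singleton _)
  have m1 : Measurable (Set.indicator {1} 1 : ℝ → ENNReal) :=
    measurable_one.indicator (measurableSet_singleton _)
  set S := ∑' n, a n with hS
  have hS0 : 0 ≤ S := tsum_nonneg ha
  have hq : 0 ≤ 1 - α := by linarith
  have hterm : ∀ n k, ∫⁻ ω, firstOne κ n ω * ENNReal.ofReal (tailSum a κ θ n k ω) ^ p ∂μ
      ≤ 4 ^ p * (ENNReal.ofReal p ^ p * ENNReal.ofReal (1 - α)
          * (ENNReal.ofReal α ^ n * ENNReal.ofReal (a n) ^ p)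
        + ENNReal.ofReal α ^ n * ENNReal.ofReal (1 - α) * ENNReal.ofReal ((1 - α) * S) ^ p) := by
    intro n k
    have hSk : ∑ m ∈ Finset.range k, a (n + 1 + m) ≤ S := by
      rw [hS, ← hsum.sum_add_tsum_nat_add (n + 1)]
      have h2 := ((summable_nat_add_iff (n + 1)).2 hsum).sum_le_tsum (Finset.range k)
        fun m _ => ha _
      have h3 : 0 ≤ ∑ m ∈ Finset.range (n + 1), a m := Finset.sum_nonneg fun m _ => ha m
      simp only [add_comm _ (n + 1)] at h2 ⊢
      linarith
    refine (h.lintegral_weight_mul_rpow_le h0 h1 ha hanti n k hp0 hSk m0 m1).trans ?_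
    rw [bernoulliMean_indicator_zero, bernoulliMean_indicator_one, mul_assoc _ 2]
    refine (mul_le_mul_right (two_mul_ofReal_add_rpow_le (mul_nonneg hp0.le (ha n))
      (mul_nonneg hq hS0) hp) _).trans (le_of_eq ?_)
    rw [ENNReal.ofReal_mul hp0.le, ENNReal.mul_rpow_of_nonneg _ _ hp0.le]
    ring
  refine lintegral_le_of_tendsto_ae (F := fun N ω =>
    ENNReal.ofReal (∑ m ∈ Finset.range N, a m * κ m ω * θ m ω) ^ p)
    (fun N => ((Finset.measurable_sum (Finset.range N) fun m _ =>
      h.measurable_term a m).ennreal_ofReal.pow_const p).aemeasurable) ?_ fun N => ?_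
  · filter_upwards [h.ae_summable h0 h1 ha hsum] with ω hω
    exact (ENNReal.tendsto_ofReal hω.hasSum.tendsto_sum_nat).ennrpow_const p
  calc _ ≤ ∫⁻ ω, ∑ n ∈ Finset.range N, firstOne κ n ω
          * ENNReal.ofReal (tailSum a κ θ n (N - 1 - n) ω) ^ p ∂μ := by
        refine lintegral_mono_ae ?_
        filter_upwards [h.ae_kappa h0 h1] with ω hω
          using sum_range_rpow_le_sum_firstOne hω hp0 N
    _ = ∑ n ∈ Finset.range N, ∫⁻ ω, firstOne κ n ω
          * ENNReal.ofReal (tailSum a κ θ n (N - 1 - n) ω) ^ p ∂μ :=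
        lintegral_finsetSum _ fun n _ => mterm n _
    _ ≤ ∑ n ∈ Finset.range N, 4 ^ p * (ENNReal.ofReal p ^ p * ENNReal.ofReal (1 - α)
          * (ENNReal.ofReal α ^ n * ENNReal.ofReal (a n) ^ p)
        + ENNReal.ofReal α ^ n * ENNReal.ofReal (1 - α) * ENNReal.ofReal ((1 - α) * S) ^ p) :=
        Finset.sum_le_sum fun n _ => hterm n _
    _ = 4 ^ p * (ENNReal.ofReal p ^ p * ENNReal.ofReal (1 - α)
          * (∑ n ∈ Finset.range N, ENNReal.ofReal α ^ n * ENNReal.ofReal (a n) ^ p)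
        + (∑ n ∈ Finset.range N, ENNReal.ofReal α ^ n * ENNReal.ofReal (1 - α))
          * ENNReal.ofReal ((1 - α) * S) ^ p) := by
        rw [← Finset.mul_sum, Finset.sum_add_distrib, ← Finset.mul_sum, ← Finset.sum_mul]
    _ ≤ _ := by
        refine mul_le_mul_right (add_le_add (mul_le_mul_right (ENNReal.sum_le_tsum _) _) ?_) _
        exact mul_le_of_le_one_left' (sum_ofReal_pow_mul_le_one h0 N)

lemma le_lintegral_mixtureSum_rpow [IsProbabilityMeasure μ] (h : IsMixtureSetting μ α κ θ)
    (h0 : 0 ≤ α) (h1 : α < 1) {a : ℕ → ℝ} (ha : ∀ n, 0 ≤ a n) (hsum : Summable a) {p : ℝ}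
    (hp : 0 < p) :
    ENNReal.ofReal (p * Real.exp (-1)) ^ p * ENNReal.ofReal (1 - α)
        * ∑' n, ENNReal.ofReal α ^ n * ENNReal.ofReal (a n) ^ p
      ≤ ∫⁻ ω, ENNReal.ofReal (mixtureSum a κ θ ω) ^ p ∂μ := by
  have mg : ∀ n, Measurable fun x : ℝ => ENNReal.ofReal (a n * x) ^ p := fun n => by fun_prop
  calc _ = ∑' n, ENNReal.ofReal α ^ n * ENNReal.ofReal (1 - α)
          * (ENNReal.ofReal (a n) ^ p * ENNReal.ofReal (p * Real.exp (-1)) ^ p) := by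
        rw [← ENNReal.tsum_mul_left]
        congr with n
        ring
    _ ≤ ∑' n, ∫⁻ ω, firstOne κ n ω * ENNReal.ofReal (a n * θ n ω) ^ p ∂μ := by
        refine ENNReal.tsum_le_tsum fun n => ?_
        rw [h.lintegral_firstOne_mul h0 h1 n (mg n)]
        refine mul_le_mul_right ((mul_le_mul_right (le_lintegral_rpow_expMeasure hp) _).trans
          (le_of_eq ?_)) _
        rw [← lintegral_const_mul _ (by fun_prop)]
        congr with x
        rw [ENNReal.ofReal_mul (ha n), ENNReal.mul_rpow_of_nonneg _ _ hp.le]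
    _ = ∫⁻ ω, ∑' n, firstOne κ n ω * ENNReal.ofReal (a n * θ n ω) ^ p ∂μ := by
        refine (lintegral_tsum fun n => ?_).symm
        exact ((h.measurable_firstOne n).mul
          ((mg n).comp (h.measurable_theta n))).aemeasurable
    _ ≤ _ := by
        refine lintegral_mono_ae ?_
        filter_upwards [h.ae_kappa h0 h1, h.ae_theta_nonneg, h.ae_summable h0 h1 ha hsum]
          with ω hκ hθ hs using tsum_firstOne_le ha hκ hθ hs hp

end IsMixtureSetting
end Setting

lemma ofReal_weighted_rpow {α p : ℝ} {a : ℕ → ℝ} (h0 : 0 ≤ α) (h1 : α < 1) (ha : ∀ n, 0 ≤ a n)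
    (hanti : Antitone a) (hp : 0 < p) {d : ℝ} (hd : 0 ≤ d) :
    ENNReal.ofReal (d * (1 - α) ^ (1 / p) * (∑' n, α ^ n * a n ^ p) ^ (1 / p)) ^ p
      = ENNReal.ofReal d ^ p * ENNReal.ofReal (1 - α)
        * ∑' n, ENNReal.ofReal α ^ n * ENNReal.ofReal (a n) ^ p := by
  have hq : 0 ≤ 1 - α := by linarith
  have hnn : ∀ n, 0 ≤ α ^ n * a n ^ p := fun n =>
    mul_nonneg (pow_nonneg h0 n) (Real.rpow_nonneg (ha n) p)
  have hs : Summable fun n => α ^ n * a n ^ p := by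
    refine Summable.of_nonneg_of_le hnn (fun n => ?_)
      ((summable_geometric_of_lt_one h0 h1).mul_right (a 0 ^ p))
    exact mul_le_mul_of_nonneg_left (Real.rpow_le_rpow (ha n) (hanti (Nat.zero_le n)) hp.le)
      (pow_nonneg h0 n)
  have e : ∀ x : ℝ, 0 ≤ x → ENNReal.ofReal (x ^ (1 / p)) ^ p = ENNReal.ofReal x := fun x hx => by
    rw [ENNReal.ofReal_rpow_of_nonneg (by positivity) hp.le, one_div,
      Real.rpow_inv_rpow hx hp.ne']
  rw [ENNReal.ofReal_mul (by positivity), ENNReal.ofReal_mul hd,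
    ENNReal.mul_rpow_of_nonneg _ _ hp.le, ENNReal.mul_rpow_of_nonneg _ _ hp.le, e _ hq,
    e _ (tsum_nonneg hnn), ENNReal.ofReal_tsum_of_nonneg hnn hs]
  congr with n
  rw [ENNReal.ofReal_mul (pow_nonneg h0 n), ENNReal.ofReal_pow h0,
    ENNReal.ofReal_rpow_of_nonneg (ha n) hp.le]

theorem mainTheorem6 :
    ∃ c C : ℝ, 0 < c ∧ 0 < C ∧
      ∀ (Ω : Type*) [MeasurableSpace Ω] (μ : Measure Ω) [IsProbabilityMeasure μ]
        (α : ℝ) (κ θ : ℕ → Ω → ℝ) (a : ℕ → ℝ) (p : ℝ),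
        0 ≤ α → α < 1 → IsMixtureSetting μ α κ θ →
        (∀ n, 0 ≤ a n) → Antitone a → Summable a → 2 ≤ p →
          (∀ᵐ ω ∂μ, Summable fun n => a n * κ n ω * θ n ω) ∧
          (MemLp (mixtureSum a κ θ) (ENNReal.ofReal p) μ ∧
            c * (p * (1 - α) ^ (1 / p) * (∑' n, α ^ n * a n ^ p) ^ (1 / p)
                + (1 - α) * ∑' n, a n)
              ≤ (eLpNorm (mixtureSum a κ θ) (ENNReal.ofReal p) μ).toReal ∧
            (eLpNorm (mixtureSum a κ θ) (ENNReal.ofReal p) μ).toReal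
              ≤ C * (p * (1 - α) ^ (1 / p) * (∑' n, α ^ n * a n ^ p) ^ (1 / p)
                + (1 - α) * ∑' n, a n)) ∧
          (MemLp (mixtureSigma a κ θ) (ENNReal.ofReal p) μ ∧
            c * (p * a 0 + (1 - α) * ∑' n, a (n + 1))
              ≤ (eLpNorm (mixtureSigma a κ θ) (ENNReal.ofReal p) μ).toReal ∧
            (eLpNorm (mixtureSigma a κ θ) (ENNReal.ofReal p) μ).toReal
              ≤ C * (p * a 0 + (1 - α) * ∑' n, a (n + 1))) := by
  refine ⟨Real.exp (-1) / 2, 4, by positivity, by norm_num, ?_⟩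
  intro Ω _ μ _ α κ θ a p h0 h1 h ha hanti hsum hp2
  have hp : 1 ≤ p := by linarith
  have hp0 : 0 < p := by linarith
  have hq : 0 ≤ 1 - α := by linarith
  have hpos : ∀ᵐ ω ∂μ, ∀ n, 0 ≤ a n * κ n ω * θ n ω := by
    filter_upwards [h.ae_kappa h0 h1, h.ae_theta_nonneg] with ω hκ hθ n
    refine mul_nonneg (mul_nonneg (ha n) ?_) (hθ n)
    rcases hκ n with h | h <;> simp [h]
  have hsm := h.ae_summable h0 h1 ha hsum
  have hT : 0 ≤ ∑' n, α ^ n * a n ^ p := tsum_nonneg fun n =>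
    mul_nonneg (pow_nonneg h0 n) (Real.rpow_nonneg (ha n) p)
  have hU : 0 ≤ p * (1 - α) ^ (1 / p) * (∑' n, α ^ n * a n ^ p) ^ (1 / p) :=
    mul_nonneg (mul_nonneg hp0.le (Real.rpow_nonneg hq _)) (Real.rpow_nonneg hT _)
  refine ⟨hsm, memLp_and_eLpNorm_bounds (h.aemeasurable_mixtureSum h0 h1 ha hsum) ?_ hp
      hU (mul_nonneg hq (tsum_nonneg ha)) ?_ ?_ ?_,
    memLp_and_eLpNorm_bounds (h.aemeasurable_mixtureSigma h0 h1 ha hsum) ?_ hp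
      (mul_nonneg hp0.le (ha 0)) (mul_nonneg hq (tsum_nonneg fun n => ha _))
      (h.lintegral_mixtureSigma_rpow_le h0 h1 ha hanti hsum hp)
      (h.le_lintegral_mixtureSigma_rpow h0 h1 ha hp0) ?_⟩
  · filter_upwards [hpos] with ω hω using tsum_nonneg hω
  · refine (h.lintegral_mixtureSum_rpow_le h0 h1 ha hanti hsum hp).trans ?_
    rw [← ofReal_weighted_rpow h0 h1 ha hanti hp0 hp0.le,
      ENNReal.ofReal_mul (by norm_num : (0 : ℝ) ≤ 4), ENNReal.mul_rpow_of_nonneg _ _ hp0.le,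
      ENNReal.ofReal_ofNat, ENNReal.ofReal_add hU (mul_nonneg hq (tsum_nonneg ha))]
    exact mul_le_mul_right (ENNReal.add_rpow_le_rpow_add _ _ hp) _
  · have e : Real.exp (-1) * (p * (1 - α) ^ (1 / p) * (∑' n, α ^ n * a n ^ p) ^ (1 / p))
        = p * Real.exp (-1) * (1 - α) ^ (1 / p) * (∑' n, α ^ n * a n ^ p) ^ (1 / p) := by ring
    rw [e, ofReal_weighted_rpow h0 h1 ha hanti hp0 (by positivity)]
    exact h.le_lintegral_mixtureSum_rpow h0 h1 ha hsum hp0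
  · refine (h.ofReal_exp_mul_le_lintegral_tsum h0 h1 ha hsum id).trans (lintegral_mono_ae ?_)
    filter_upwards [hpos, hsm] with ω hω hs
    exact (ENNReal.ofReal_tsum_of_nonneg hω hs).ge
  · filter_upwards [hpos, h.ae_theta_nonneg] with ω hω hθ
    exact add_nonneg (mul_nonneg (ha 0) (hθ 0)) (tsum_nonneg fun n => hω (n + 1))
  · refine (h.ofReal_exp_mul_le_lintegral_tsum h0 h1 (fun n => ha (n + 1))
      ((summable_nat_add_iff 1).2 hsum) (· + 1)).trans (lintegral_mono_ae ?_)
    filter_upwards [hpos, hsm, h.ae_theta_nonneg] with ω hω hs hθ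
    rw [← ENNReal.ofReal_tsum_of_nonneg (fun n => hω (n + 1)) ((summable_nat_add_iff 1).2 hs)]
    exact ENNReal.ofReal_le_ofReal (le_add_of_nonneg_left (mul_nonneg (ha 0) (hθ 0)))
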